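/- Let $K$ be a field of characteristic zero, let $1\le n\le m$ be integers, and let $K(t,x_1,\dots,x_m)$ be the field of rational functions in $t,x_1,\dots,x_m$. For each variable $v$ let $\sigma_v$ be the $K$-automorphism of $K(t,x_1,\dots,x_m)$ with $\sigma_v(v)=v+1$ that fixes all the other variables, and put $\Delta_{x_i}(g)=\sigma_{x_i}(g)-g$. Let $G=\langle\sigma_{x_1},\dots,\sigma_{x_n}\rangle$ and $G_t=\langle\sigma_t,\sigma_{x_1},\dots,\sigma_{x_n}\rangle$. For a polynomial $p$, let $G_p=\{\tau\in G\mid\tau(p)=p\}$ and $G_{t,p}=\{\tau\in G_t\mid\tau(p)=p\}$; two polynomials are $G$-equivalent if they have the same $G$-orbit. A rational function $f\in K(t,x_1,\dots,x_m)$ is $(\sigma_{x_1},\dots,\sigma_{x_n})$-summable if $f=\Delta_{x_1}(g_1)+\cdots+\Delta_{x_n}(g_n)$ for some $g_1,\dots,g_n\in K(t,x_1,\dots,x_m)$. A telescoper of type $(\sigma_t;\sigma_{x_1},\dots,\sigma_{x_n})$ for $f$ is a nonzero operator $L=\sum_{\ell} e_\ell S_t^\ell\in K(t)\langle S_t\rangle$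 such that $L(f)=\sum_\ell e_\ell\,\sigma_t^\ell(f)$ is $(\sigma_{x_1},\dots,\sigma_{x_n})$-summable. Let $I\ge 0$ and $j\ge 1$ be integers, let $d\in K[t,x_1,\dots,x_m]$ be irreducible, and let $a_0,\dots,a_I\in K(t,x_2,\dots,x_m)[x_1]$ satisfy $\deg_{x_1}(a_i)<\deg_{x_1}(d)$ for all $i$. Suppose that $\sigma_t^i(d)$ and $\sigma_t^{i'}(d)$ are not $G$-equivalent for $0\le i\ne i'\le I$, and let $$f=\sum_{i=0}^I\frac{a_i}{\sigma_t^i(d)^j}.$$ If $\operatorname{rank}(G_{t,d}/G_d)=0$, then $f$ has a telescoper of type $(\sigma_t;\sigma_{x_1},\dots,\sigma_{x_n})$ if and only if $a_i/\sigma_t^i(d)^j$ is $(\sigma_{x_1},\dots,\sigma_{x_n})$-summable in $K(t,x_1,\dots,x_m)$ for every $0\le i\le I$. -/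

import Mathlib

noncomputable section

namespace ShiftTelescoper

/-- The index set of the variables `t, x_1, …, x_m`: `none` stands for `t`, and
`some i` stands for `x_{i+1}` (`0 ≤ i < m`). -/
abbrev Var (m : ℕ) : Type := Option (Fin m)

/-- The polynomial ring `K[t, x_1, …, x_m]`. -/
abbrev Poly (K : Type*) [Field K] (m : ℕ) : Type _ := MvPolynomial (Var m) K

/-- The field of rational functions `K(t, x_1, …, x_m)`. -/
abbrev RatFun (K : Type*) [Field K] (m : ℕ) : Type _ := FractionRing (Poly K m)

/-- The variable `x_1`. -/
def x₁ {m : ℕ} (hm : 1 ≤ m) : Var m := some ⟨0, hm⟩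

section Shift

variable (K : Type*) [Field K] {m : ℕ}

/-- The variable `v` as an element of `K(t, x_1, …, x_m)`. -/
def var (v : Var m) : RatFun K m := algebraMap (Poly K m) (RatFun K m) (MvPolynomial.X v)

/-- The shift `v ↦ v + 1`, fixing the other variables, on `K[t, x_1, …, x_m]`. -/
def polyShift (v : Var m) : Poly K m ≃ₐ[K] Poly K m :=
  AlgEquiv.ofAlgHom
    (MvPolynomial.aeval fun w => MvPolynomial.X w + if w = v then 1 else 0)
    (MvPolynomial.aeval fun w => MvPolynomial.X w - if w = v then 1 else 0)
    (by
      apply MvPolynomial.algHom_ext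
      intro w
      by_cases h : w = v <;> simp [h])
    (by
      apply MvPolynomial.algHom_ext
      intro w
      by_cases h : w = v <;> simp [h])

/-- The shift operator `σ_v`: the `K`-automorphism of `K(t, x_1, …, x_m)` with
`σ_v(v) = v + 1` and `σ_v(w) = w` for every other variable `w`. -/
def shift (v : Var m) : RatFun K m ≃ₐ[K] RatFun K m :=
  IsFractionRing.fieldEquivOfAlgEquiv K (RatFun K m) (RatFun K m) (polyShift K v)

@[simp]
theorem shift_algebraMap (v : Var m) (p : Poly K m) :
    shift K v (algebraMap (Poly K m) (RatFun K m) p) =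
      algebraMap (Poly K m) (RatFun K m) (polyShift K v p) :=
  IsFractionRing.fieldEquivOfAlgEquiv_algebraMap K (RatFun K m) (RatFun K m) (polyShift K v) p

theorem shift_var_self (v : Var m) : shift K v (var K v) = var K v + 1 := by
  simp [var, polyShift]

theorem shift_var_of_ne {v w : Var m} (h : w ≠ v) : shift K v (var K w) = var K w := by
  simp [var, polyShift, h]

theorem shift_comm (v w : Var m) : shift K v * shift K w = shift K w * shift K v := by
  have h : polyShift K v * polyShift K w = polyShift K w * polyShift K v := by
    apply AlgEquiv.coe_toAlgHom_injective
    apply MvPolynomial.algHom_ext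
    intro u
    by_cases hv : u = v <;> by_cases hw : u = w <;>
      simp [polyShift, hv, hw, add_comm, add_left_comm]
  have h' := congrArg (IsFractionRing.fieldEquivOfAlgEquivHom K (RatFun K m)) h
  rw [map_mul, map_mul] at h'
  exact h'

variable (m)

/-- `G_t = ⟨σ_t, σ_{x_1}, …, σ_{x_n}⟩`, as a group of automorphisms of `K(t, x_1, …, x_m)`. -/
def groupT (n : ℕ) : Subgroup (RatFun K m ≃ₐ[K] RatFun K m) :=
  Subgroup.closure
    (insert (shift K none) {σ | ∃ i : Fin m, i.val < n ∧ σ = shift K (some i)})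

/-- `G = ⟨σ_{x_1}, …, σ_{x_n}⟩`. -/
def groupX (n : ℕ) : Subgroup (RatFun K m ≃ₐ[K] RatFun K m) :=
  Subgroup.closure {σ | ∃ i : Fin m, i.val < n ∧ σ = shift K (some i)}

theorem groupT_comm (n : ℕ) {σ τ : RatFun K m ≃ₐ[K] RatFun K m}
    (hσ : σ ∈ groupT K m n) (hτ : τ ∈ groupT K m n) : Commute σ τ := by
  refine Subgroup.closure_induction₂ (p := fun x y _ _ => Commute x y) ?_
    (fun x _ => Commute.one_left x) (fun x _ => Commute.one_right x)
    (fun _ _ _ _ _ _ h₁ h₂ => Commute.mul_left h₁ h₂)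
    (fun _ _ _ _ _ _ h₁ h₂ => Commute.mul_right h₁ h₂)
    (fun _ _ _ _ h => Commute.inv_left h) (fun _ _ _ _ h => Commute.inv_right h) hσ hτ
  have key : ∀ ρ ∈ insert (shift K none)
      {σ : RatFun K m ≃ₐ[K] RatFun K m | ∃ i : Fin m, i.val < n ∧ σ = shift K (some i)},
      ∃ v : Var m, ρ = shift K v := by
    rintro ρ (rfl | ⟨i, -, rfl⟩)
    exacts [⟨_, rfl⟩, ⟨_, rfl⟩]
  intro x y hx hy
  obtain ⟨v, rfl⟩ := key x hx
  obtain ⟨w, rfl⟩ := key y hy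
  exact shift_comm K v w

end Shift

section Isotropy

variable {K : Type*} [Field K] {m : ℕ}

/-- Two polynomials, as elements of `K(t, x_1, …, x_m)`, are `A`-equivalent if they have the same orbit under `A`. -/
def ShiftEquivalent (A : Subgroup (RatFun K m ≃ₐ[K] RatFun K m)) (p q : RatFun K m) : Prop :=
  MulAction.orbit A p = MulAction.orbit A q

/-- The isotropy group `A_p = {σ ∈ A | σ(p) = p}`. -/
def isotropy (A : Subgroup (RatFun K m ≃ₐ[K] RatFun K m)) (p : RatFun K m) :
    Subgroup (RatFun K m ≃ₐ[K] RatFun K m) where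
  carrier := {σ | σ ∈ A ∧ σ p = p}
  mul_mem' := fun ha hb => ⟨A.mul_mem ha.1 hb.1, by
    rw [AlgEquiv.mul_apply, hb.2, ha.2]⟩
  one_mem' := ⟨A.one_mem, rfl⟩
  inv_mem' := fun {a} ha => ⟨A.inv_mem ha.1, by
    have h : a.symm (a p) = a.symm p := congrArg a.symm ha.2
    rw [AlgEquiv.symm_apply_apply] at h
    exact h.symm⟩

/-- `G_{t,p}` is commutative. -/
instance isotropyCommGroup (n : ℕ) (p : RatFun K m) : CommGroup (isotropy (groupT K m n) p) :=
  { (inferInstance : Group (isotropy (groupT K m n) p)) with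
    mul_comm := fun a b => Subtype.ext (groupT_comm K m n a.2.1 b.2.1) }

/-- The rank of the abelian group `G_{t,p} / G_p`. -/
def isotropyQuotientRank (n : ℕ) (p : RatFun K m) : Cardinal :=
  Module.rank ℤ (Additive (isotropy (groupT K m n) p ⧸
    (isotropy (groupX K m n) p).subgroupOf (isotropy (groupT K m n) p)))

end Isotropy

section Telescoper

variable (K : Type*) [Field K] (m : ℕ)

/-- The subfield `K(t)` of `K(t, x_1, …, x_m)`. -/
def fieldT : IntermediateField K (RatFun K m) := 
  IntermediateField.adjoin K {var K (none : Var m)}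

/-- The subfield of `K(t, x_1, …, x_m)` of the rational functions in the variables other than `v`;
for `v = x_1` it is `K(t, x_2, …, x_m)`. -/
def fieldOmit (v : Var m) : IntermediateField K (RatFun K m) :=
  IntermediateField.adjoin K (var K '' {w | w ≠ v})

theorem shift_mem_fieldT {e : RatFun K m} (he : e ∈ fieldT K m) :
    shift K none e ∈ fieldT K m := by
  have h : fieldT K m ≤
      (fieldT K m).comap (shift K (none : Var m) : RatFun K m →ₐ[K] RatFun K m) := by
    refine IntermediateField.adjoin_le_iff.2 ?_
    rintro _ rfl
    change shift K none (var K none) ∈ fieldT K m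
    rw [shift_var_self]
    exact add_mem (IntermediateField.mem_adjoin_simple_self K _) (one_mem _)
  exact h he

/-- The restriction of `σ_t` to `K(t)`. -/
def shiftT : fieldT K m →+* fieldT K m :=
  ((shift K (none : Var m) : RatFun K m →+* RatFun K m).comp
    (algebraMap (fieldT K m) (RatFun K m))).codRestrict
      (fieldT K m) (fun e => shift_mem_fieldT K m e.2)

/-- `σ_t` acting on `K(t)`, which fixes the commutation rule `S_t e = σ_t(e) S_t` of the ring of
skew polynomials over `K(t)`. -/
instance shiftTAction : MulSemiringAction (Multiplicative ℕ) (fieldT K m) :=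
  MulSemiringAction.compHom _ (powersHom (fieldT K m →+* fieldT K m) (shiftT K m))

/-- The ring `K(t)⟨S_t⟩` of linear recurrence operators. -/
abbrev RecOp : Type _ := SkewPolynomial (fieldT K m)

variable {K m}

/-- The action `L(f) = ∑_ℓ e_ℓ σ_t^ℓ(f)` of `L = ∑_ℓ e_ℓ S_t^ℓ`. -/
def RecOp.apply (L : RecOp K m) (f : RatFun K m) : RatFun K m :=
  SkewPolynomial.sum L fun l e => (e : RatFun K m) * ((shift K none) ^ l) f

/-- `σ_t^i(d)` as an element of `K(t, x_1, …, x_m)`. -/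
def iterShiftT (i : ℕ) (d : Poly K m) : RatFun K m :=
  (shift K none ^ i) (algebraMap (Poly K m) (RatFun K m) d)

/-- The simple fraction `a / σ_t^i(d)^j`, where the numerator `a` is a polynomial in the variable
`v` over the field of rational functions in the other variables. -/
def simpleFraction (v : Var m) (a : Polynomial (fieldOmit K m v)) (d : Poly K m) (i j : ℕ) :
    RatFun K m :=
  Polynomial.aeval (var K v) a / iterShiftT i d ^ j

/-- The difference operator `Δ_v = σ_v - 1`. -/
def delta (v : Var m) (g : RatFun K m) : RatFun K m := shift K v g - g

/-- `f` is `(σ_{x_1}, …, σ_{x_n})`-summable in `K(t, x_1, …, x_m)` (for `n ≤ m`). -/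
def IsSummable (n : ℕ) (f : RatFun K m) : Prop :=
  ∃ g : Fin m → RatFun K m, f = ∑ i : Fin m with i.val < n, delta (some i) (g i)

/-- `L` is a telescoper of type `(σ_t; σ_{x_1}, …, σ_{x_n})` for `f` (for `n ≤ m`). -/
def IsTelescoper (n : ℕ) (L : RecOp K m) (f : RatFun K m) : Prop :=
  L ≠ 0 ∧ IsSummable n (L.apply f)

/-- `f` has a telescoper of type `(σ_t; σ_{x_1}, …, σ_{x_n})`. -/
def HasTelescoper (n : ℕ) (f : RatFun K m) : Prop := ∃ L : RecOp K m, IsTelescoper n L f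

end Telescoper

end ShiftTelescoper

end

/-!
Regard a rational function as a function of the single variable `v = x_1` over the field
`E = K(w : w ≠ v)`. For a polynomial `y` let `T ⊆ E[v]` be its `G`-orbit. By Bézout,
`K(t, x_1, …, x_m)` is the direct sum of `properPart T`, the proper fractions whose denominators are
products of elements of `T`, and `coprimePart T`, the fractions whose denominators are coprime
to `T`. Elements of `G` map `E[v]` to itself and preserve degrees in `v`, so both summands are stable
under `G`. A decomposition into differences can therefore be projected to the first summand: if
`w + b` is summable with `w` in `properPart T` and `b` in `coprimePart T`, then `w` is summable
(`IsSummable.of_add_mem_coprimePart`).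

If `G_{t,d} / G_d` has rank zero, then all elements of `G_{t,d}` fix `t`, because this quotient embeds
into the infinite cyclic group `G_t / G`. Hence the shifts `σ_t^k(d)` lie in distinct `G`-orbits. They
are not even associated up to `G`, since a translation of the variables preserves the homogeneous
part of highest degree and so has no eigenvalue other than `1`. By Gauss's lemma, elements of
distinct orbits are coprime in `E[v]` (`isCoprime_of_mem_orbitLifts`).

Now let `L = ∑ e_l S_t^l` be a telescoper with lowest term `e_{l₀} S_t^{l₀}`, and `u_i` the simple fraction
with denominator `σ_t^i(d)^j`. In `L(f) = ∑ e_l σ_t^l(u_i)`, a term other than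
`e_{l₀} σ_t^{l₀}(u_i)` whose denominator lies over the orbit of `σ_t^{l₀+i}(d)` involves some `u_{i'}`
with `i' < i`. By induction on `i` these terms are summable, hence so is
`e_{l₀} σ_t^{l₀}(u_i)`, and `e_{l₀} σ_t^{l₀}` can be undone because it commutes with the difference
operators (`isSummable_simpleFraction_of_isTelescoper`). Conversely, a sum of summable functions has
the telescoper `1`.
-/

noncomputable section

namespace ShiftTelescoper

/-! ### Translations of the variables -/

section Translations

variable (K : Type*) [Field K] (m : ℕ)

/-- The automorphisms of `K(t, x_1, …, x_m)` that add a constant of `K` to every variable. -/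
def translations : Subgroup (RatFun K m ≃ₐ[K] RatFun K m) where
  carrier := {τ | ∀ w, ∃ c : K, τ (var K w) = var K w + algebraMap K (RatFun K m) c}
  mul_mem' := by
    intro σ τ hσ hτ w
    obtain ⟨a, ha⟩ := hσ w
    obtain ⟨b, hb⟩ := hτ w
    exact ⟨a + b, by
      rw [AlgEquiv.mul_apply, hb, map_add, ha, AlgEquiv.commutes, map_add, add_assoc]⟩
  one_mem' := fun w => ⟨0, by simp⟩
  inv_mem' := by
    intro τ hτ w
    obtain ⟨c, hc⟩ := hτ w
    refine ⟨-c, ?_⟩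
    change τ.symm (var K w) = _
    rw [AlgEquiv.symm_apply_eq, map_add, hc, AlgEquiv.commutes, map_neg, add_neg_cancel_right]

theorem shift_mem_translations (v : Var m) : shift K v ∈ translations K m := by
  intro w
  by_cases h : w = v
  · subst h
    exact ⟨1, by rw [shift_var_self, map_one]⟩
  · exact ⟨0, by rw [shift_var_of_ne K h, map_zero, add_zero]⟩

theorem groupT_le_translations (n : ℕ) : groupT K m n ≤ translations K m := by
  refine (Subgroup.closure_le _).2 ?_
  rintro _ (rfl | ⟨i, -, rfl⟩) <;> exact shift_mem_translations K m _

theorem groupX_le_groupT (n : ℕ) : groupX K m n ≤ groupT K m n :=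
  Subgroup.closure_mono (Set.subset_insert _ _)

theorem shift_none_mem_groupT (n : ℕ) : shift K none ∈ groupT K m n :=
  Subgroup.subset_closure (Set.mem_insert _ _)

variable {K m}

theorem shift_mem_groupX {n : ℕ} {i : Fin m} (hi : i.val < n) :
    shift K (some i) ∈ groupX K m n :=
  Subgroup.subset_closure ⟨i, hi, rfl⟩

theorem apply_var_none_of_mem_groupX {n : ℕ} {τ : RatFun K m ≃ₐ[K] RatFun K m}
    (hτ : τ ∈ groupX K m n) : τ (var K none) = var K none := by
  suffices groupX K m n ≤ MulAction.stabilizer (RatFun K m ≃ₐ[K] RatFun K m)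
      (var K (none : Var m)) from this hτ
  refine (Subgroup.closure_le _).2 ?_
  rintro _ ⟨i, -, rfl⟩
  exact shift_var_of_ne K (by simp)

theorem pow_shift_none_apply_var (k : ℕ) :
    (shift K none ^ k) (var K (none : Var m)) = var K none + (k : RatFun K m) := by
  induction k with
  | zero => simp
  | succ k ih => rw [pow_succ', AlgEquiv.mul_apply, ih, map_add, shift_var_self]; simp; ring

/-- The translation `w ↦ w + c w` of the polynomial ring. -/
def polyTranslate (c : Var m → K) : Poly K m ≃ₐ[K] Poly K m :=
  AlgEquiv.ofAlgHom
    (MvPolynomial.aeval fun w => MvPolynomial.X w + MvPolynomial.C (c w))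
    (MvPolynomial.aeval fun w => MvPolynomial.X w - MvPolynomial.C (c w))
    (by ext w : 1; simp [MvPolynomial.algHom_C])
    (by ext w : 1; simp [MvPolynomial.algHom_C])

@[simp]
theorem polyTranslate_X (c : Var m → K) (w : Var m) :
    polyTranslate c (MvPolynomial.X w) = MvPolynomial.X w + MvPolynomial.C (c w) := by
  simp [polyTranslate]

theorem exists_polyTranslate {τ : RatFun K m ≃ₐ[K] RatFun K m} (hτ : τ ∈ translations K m) :
    ∃ c : Var m → K, ∀ p : Poly K m,
      τ (algebraMap (Poly K m) (RatFun K m) p) =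
        algebraMap (Poly K m) (RatFun K m) (polyTranslate c p) := by
  choose c hc using hτ
  refine ⟨c, fun p => ?_⟩
  have h : (τ : RatFun K m →ₐ[K] RatFun K m).comp
        (IsScalarTower.toAlgHom K (Poly K m) (RatFun K m)) =
      (IsScalarTower.toAlgHom K (Poly K m) (RatFun K m)).comp
        (polyTranslate c : Poly K m →ₐ[K] Poly K m) := by
    apply MvPolynomial.algHom_ext
    intro w
    have := hc w
    simp only [var] at this
    simpa [this] using IsScalarTower.algebraMap_apply K (Poly K m) (RatFun K m) (c w)
  exact DFunLike.congr_fun h p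

/-- A translation does not change the coefficients in the top total degree. -/
theorem coeff_polyTranslate (c : Var m → K) (p : Poly K m) (s : Var m →₀ ℕ)
    (hs : p.totalDegree ≤ s.degree) : (polyTranslate c p).coeff s = p.coeff s := by
  have key : ∀ (r : Var m →₀ ℕ) (a : K) (s : Var m →₀ ℕ),
      (MvPolynomial.monomial r a).totalDegree ≤ s.degree →
      (polyTranslate c (MvPolynomial.monomial r a)).coeff s =
        (MvPolynomial.monomial r a).coeff s := by
    refine MvPolynomial.induction_on_monomial ?_ ?_
    · intro a s _
      rw [← MvPolynomial.algebraMap_eq, AlgEquiv.commutes]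
    · intro p w ih s hs
      rcases eq_or_ne p 0 with rfl | hp
      · simp
      rw [MvPolynomial.totalDegree_mul_of_isDomain hp (MvPolynomial.X_ne_zero w),
        MvPolynomial.totalDegree_X] at hs
      rw [map_mul, polyTranslate_X, mul_add, MvPolynomial.coeff_add, mul_comm _ (MvPolynomial.C _),
        MvPolynomial.coeff_C_mul, ih s (by omega),
        MvPolynomial.coeff_eq_zero_of_totalDegree_lt (f := p), mul_zero, add_zero,
        MvPolynomial.coeff_mul_X', MvPolynomial.coeff_mul_X']
      · split_ifs with hw
        · refine ih _ ?_
          have h1 : (s - Finsupp.single w 1) + Finsupp.single w 1 = s :=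
            tsub_add_cancel_of_le (by
              rw [Finsupp.single_le_iff]
              exact Nat.one_le_iff_ne_zero.2 (Finsupp.mem_support_iff.1 hw))
          have h2 := congrArg Finsupp.degree h1
          rw [map_add, Finsupp.degree_single] at h2
          omega
        · rfl
      · change p.totalDegree < s.degree
        omega
  conv_lhs => rw [p.as_sum]
  conv_rhs => rw [p.as_sum]
  rw [map_sum, MvPolynomial.coeff_sum, MvPolynomial.coeff_sum]
  refine Finset.sum_congr rfl fun r hr => key r _ s ?_
  refine ((MvPolynomial.totalDegree_monomial_le r _).trans ?_).trans hs
  exact MvPolynomial.le_totalDegree hr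

/-- An eigenvector of a translation in the polynomial ring has eigenvalue `1`. -/
theorem eq_one_of_polyTranslate_eq (c : Var m → K) {p : Poly K m} (hp : p ≠ 0) {u : K}
    (h : polyTranslate c p = MvPolynomial.C u * p) : u = 1 := by
  obtain ⟨s, hs, hd⟩ : ∃ s ∈ p.support, p.totalDegree = s.degree := by
    obtain ⟨s, hs, hd⟩ := Finset.exists_mem_eq_sup p.support
      (by simpa [Finset.nonempty_iff_ne_empty] using hp)
      (fun s => s.sum fun _ e => e)
    exact ⟨s, hs, hd⟩
  have h1 := congrArg (MvPolynomial.coeff s) h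
  rw [coeff_polyTranslate c p s hd.le, MvPolynomial.coeff_C_mul] at h1
  exact mul_right_cancel₀ (MvPolynomial.mem_support_iff.1 hs) (by rw [← h1, one_mul])

theorem exists_zpow_mem_of_rank_quotient_eq_zero {H : Type*} [CommGroup H] (N : Subgroup H)
    (h : Module.rank ℤ (Additive (H ⧸ N)) = 0) (x : H) : ∃ k : ℤ, k ≠ 0 ∧ x ^ k ∈ N := by
  obtain ⟨k, hk, hx⟩ := rank_eq_zero_iff.1 h (Additive.ofMul (QuotientGroup.mk x))
  exact ⟨k, hk, (QuotientGroup.eq_one_iff _).1 hx⟩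

/-- When `G_{t,p} / G_p` has rank zero, every element of `G_{t,p}` fixes `t`: a power of it lies in
`G`, and a nonzero shift of `t` has infinite order in characteristic zero. -/
theorem apply_var_none_of_isotropyQuotientRank_eq_zero [CharZero K] {n : ℕ} {p : RatFun K m}
    (hrank : isotropyQuotientRank n p = 0) {τ : RatFun K m ≃ₐ[K] RatFun K m}
    (hτ : τ ∈ groupT K m n) (hp : τ p = p) : τ (var K none) = var K none := by
  obtain ⟨N, hN, h⟩ := exists_zpow_mem_of_rank_quotient_eq_zero _ hrank
    (⟨τ, hτ, hp⟩ : isotropy (groupT K m n) p)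
  have h2 : τ ^ N ∈ groupX K m n := (Subgroup.mem_subgroupOf.1 h).1
  obtain ⟨c, hc⟩ := groupT_le_translations K m n hτ none
  have hpow : ∀ k : ℕ, (τ ^ k) (var K none) =
      var K none + algebraMap K (RatFun K m) (k * c) := by
    intro k
    induction k with
    | zero => simp
    | succ k ih =>
      rw [pow_succ', AlgEquiv.mul_apply, ih, map_add, hc, AlgEquiv.commutes]
      simp
      ring
  -- A natural exponent will do, since `G` is closed under inverses.
  obtain ⟨k, hk⟩ := N.eq_nat_or_neg
  have h3 : τ ^ k ∈ groupX K m n := by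
    rcases hk with rfl | rfl <;> simpa using h2
  have h4 := apply_var_none_of_mem_groupX h3
  rw [hpow, add_eq_left, map_eq_zero, mul_eq_zero] at h4
  rcases h4 with h4 | h4
  · rw [Nat.cast_eq_zero] at h4
    exact absurd (by simpa [h4] using hk) hN
  · rw [hc, h4, map_zero, add_zero]

end Translations

/-! ### Rational functions as fractions of polynomials in one variable -/

section OneVariable

variable {K : Type*} [Field K] {m : ℕ} (v : Var m)

/-- The inclusion `K[w : w ≠ v] → K(w : w ≠ v)`. -/
def toFieldOmit : MvPolynomial {w : Var m // w ≠ v} K →ₐ[K] fieldOmit K m v :=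
  MvPolynomial.aeval fun w =>
    ⟨var K w.1, IntermediateField.subset_adjoin K _ ⟨w.1, w.2, rfl⟩⟩

/-- `K[t, x_1, …, x_m] ≃ K[w : w ≠ v][v]`. -/
def splitVar : Poly K m ≃ₐ[K] Polynomial (MvPolynomial {w : Var m // w ≠ v} K) :=
  (MvPolynomial.renameEquiv K (Equiv.optionSubtypeNe v).symm).trans
    (MvPolynomial.optionEquivLeft K _)

theorem natDegree_splitVar (p : Poly K m) :
    (splitVar v p).natDegree = MvPolynomial.degreeOf v p :=
  (MvPolynomial.degreeOf_eq_natDegree v p).symm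

/-- Evaluation at the variable `v`, from `K(w : w ≠ v)[X]` to `K(t, x_1, …, x_m)`. -/
def evalVar : Polynomial (fieldOmit K m v) →+* RatFun K m :=
  (Polynomial.aeval (var K v)).toRingHom

theorem evalVar_C (e : fieldOmit K m v) : evalVar v (Polynomial.C e) = (e : RatFun K m) := by
  simp [evalVar]

theorem evalVar_X : evalVar v Polynomial.X = var K v := by
  simp [evalVar]

/-- A polynomial in all variables as a polynomial in `v` over `K(w : w ≠ v)`. -/
def liftPoly (p : Poly K m) : Polynomial (fieldOmit K m v) :=
  (splitVar v p).map (toFieldOmit (K := K) v).toRingHom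

theorem evalVar_liftPoly (p : Poly K m) :
    evalVar v (liftPoly v p) = algebraMap (Poly K m) (RatFun K m) p := by
  have h : ((Polynomial.aeval (R := fieldOmit K m v) (var K v)).restrictScalars K).comp
      ((Polynomial.mapAlgHom (toFieldOmit v)).comp
        (splitVar (K := K) v : Poly K m →ₐ[K] Polynomial (MvPolynomial {w : Var m // w ≠ v} K))) =
      IsScalarTower.toAlgHom K (Poly K m) (RatFun K m) := by
    apply MvPolynomial.algHom_ext
    intro w
    by_cases hw : w = v
    · subst hw
      simp [splitVar, var]
    · simp [splitVar, Equiv.optionSubtypeNe_symm_of_ne hw, toFieldOmit, var]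
  exact DFunLike.congr_fun h p

theorem toFieldOmit_injective : Function.Injective (toFieldOmit (K := K) v) := by
  rw [injective_iff_map_eq_zero]
  intro s hs
  have h1 : liftPoly v ((splitVar v).symm (Polynomial.C s)) = 0 := by
    rw [liftPoly, AlgEquiv.apply_symm_apply, Polynomial.map_C, Polynomial.C_eq_zero]
    exact hs
  have h2 := evalVar_liftPoly v ((splitVar v).symm (Polynomial.C s))
  rw [h1, map_zero, eq_comm, FaithfulSMul.algebraMap_eq_zero_iff] at h2
  simpa using h2

theorem degree_liftPoly {p : Poly K m} (hp : p ≠ 0) :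
    (liftPoly v p).degree = (MvPolynomial.degreeOf v p : WithBot ℕ) := by
  rw [liftPoly, Polynomial.degree_map_eq_of_injective (toFieldOmit_injective v),
    Polynomial.degree_eq_natDegree (by simpa using hp), natDegree_splitVar]

/-- `K[w : w ≠ v]` acts on `K(w : w ≠ v)` by inclusion. -/
abbrev algebraFieldOmit :
    Algebra (MvPolynomial {w : Var m // w ≠ v} K) (fieldOmit K m v) :=
  (toFieldOmit v).toRingHom.toAlgebra

attribute [local instance] algebraFieldOmit

theorem isFractionRing_fieldOmit :
    IsFractionRing (MvPolynomial {w : Var m // w ≠ v} K) (fieldOmit K m v) := by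
  have : FaithfulSMul (MvPolynomial {w : Var m // w ≠ v} K) (fieldOmit K m v) :=
    (faithfulSMul_iff_algebraMap_injective _ _).2 (toFieldOmit_injective v)
  refine IsFractionRing.of_field _ _ fun z => ?_
  have hz : (z : RatFun K m) ∈ IntermediateField.adjoin K
      (Set.range fun w : {w : Var m // w ≠ v} => var K w.1) := by
    have h : (z : RatFun K m) ∈ IntermediateField.adjoin K (var K '' {w | w ≠ v}) := z.2
    rwa [Set.image_eq_range] at h
  obtain ⟨r, s, hrs⟩ := (IntermediateField.mem_adjoin_range_iff K _ _).1 hz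
  have h (r : MvPolynomial {w : Var m // w ≠ v} K) : ((toFieldOmit v r : fieldOmit K m v) :
      RatFun K m) = MvPolynomial.aeval (fun w : {w : Var m // w ≠ v} => var K w.1) r := by
    have h' : (fieldOmit K m v).val.comp (toFieldOmit v) =
        MvPolynomial.aeval (fun w : {w : Var m // w ≠ v} => var K w.1) := by
      apply MvPolynomial.algHom_ext
      intro w
      simp [toFieldOmit]
    exact DFunLike.congr_fun h' r
  refine ⟨r, s, Subtype.ext ?_⟩
  rw [hrs, ← h, ← h]
  rfl

theorem evalVar_injective : Function.Injective (evalVar (K := K) v) := by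
  have := isFractionRing_fieldOmit (K := K) v
  rw [injective_iff_map_eq_zero]
  intro p hp
  obtain ⟨b, hb, h⟩ := IsLocalization.integerNormalization_spec
    (nonZeroDivisors (MvPolynomial {w : Var m // w ≠ v} K)) p
  set q := IsLocalization.integerNormalization
    (nonZeroDivisors (MvPolynomial {w : Var m // w ≠ v} K)) p
  have h1 : liftPoly v ((splitVar v).symm q) = Polynomial.C (toFieldOmit v b) * p := by
    rw [liftPoly, AlgEquiv.apply_symm_apply]
    rw [Algebra.smul_def, Polynomial.algebraMap_apply] at h
    exact h
  have h2 := evalVar_liftPoly v ((splitVar v).symm q)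
  rw [h1, map_mul, hp, mul_zero, eq_comm, FaithfulSMul.algebraMap_eq_zero_iff,
    EmbeddingLike.map_eq_zero_iff] at h2
  rw [h2, map_zero] at h1
  have hb0 : toFieldOmit v b ≠ 0 :=
    (map_ne_zero_iff _ (toFieldOmit_injective v)).2 (nonZeroDivisors.ne_zero hb)
  have h3 : liftPoly v (0 : Poly K m) = 0 := by simp [liftPoly]
  rw [h3, eq_comm, mul_eq_zero, Polynomial.C_eq_zero] at h1
  exact h1.resolve_left hb0

theorem exists_evalVar_div (g : RatFun K m) :
    ∃ p q : Polynomial (fieldOmit K m v), q ≠ 0 ∧ g = evalVar v p / evalVar v q := by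
  obtain ⟨p, q, hq, rfl⟩ := IsFractionRing.div_surjective (A := Poly K m) g
  refine ⟨liftPoly v p, liftPoly v q, ?_, by rw [evalVar_liftPoly, evalVar_liftPoly]⟩
  intro h
  have := evalVar_liftPoly v q
  rw [h, map_zero, eq_comm, FaithfulSMul.algebraMap_eq_zero_iff] at this
  exact nonZeroDivisors.ne_zero hq this

/-- **Gauss's lemma**: non-associated irreducible polynomials are coprime as polynomials in `v`
over the field of rational functions in the other variables, as soon as one involves `v`. -/
theorem isCoprime_liftPoly {p q : Poly K m} (hp : Irreducible p) (hq : Irreducible q)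
    (hdeg : MvPolynomial.degreeOf v q ≠ 0) (hdeg' : MvPolynomial.degreeOf v p ≠ 0)
    (h : ¬ Associated p q) : IsCoprime (liftPoly v p) (liftPoly v q) := by
  have := isFractionRing_fieldOmit (K := K) v
  have hp' : Irreducible (splitVar v p) := (MulEquiv.irreducible_iff (splitVar v)).2 hp
  have hq' : Irreducible (splitVar v q) := (MulEquiv.irreducible_iff (splitVar v)).2 hq
  have hpp := hp'.isPrimitive (by rwa [natDegree_splitVar])
  have hqp := hq'.isPrimitive (by rwa [natDegree_splitVar])
  have hpi := (hpp.irreducible_iff_irreducible_map_fraction_map (K := fieldOmit K m v)).1 hp'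
  rw [liftPoly, liftPoly]
  refine (hpi.coprime_iff_not_dvd).2 fun hdvd => h ?_
  have hdvd' := hpp.dvd_of_fraction_map_dvd_fraction_map hdvd
  have := (hp'.dvd_irreducible_iff_associated hq').1 hdvd'
  simpa using this.map (splitVar v).symm

end OneVariable

/-! ### Translations acting on polynomials in one variable -/

section TranslateOne

variable {K : Type*} [Field K] {m : ℕ} (v : Var m)

theorem apply_mem_fieldOmit {τ : RatFun K m ≃ₐ[K] RatFun K m} (hτ : τ ∈ translations K m)
    {e : RatFun K m} (he : e ∈ fieldOmit K m v) : τ e ∈ fieldOmit K m v := by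
  have h : fieldOmit K m v ≤ (fieldOmit K m v).comap (τ : RatFun K m →ₐ[K] RatFun K m) := by
    refine IntermediateField.adjoin_le_iff.2 ?_
    rintro _ ⟨w, hw, rfl⟩
    change τ (var K w) ∈ fieldOmit K m v
    obtain ⟨c, hc⟩ := hτ w
    rw [hc]
    exact add_mem (IntermediateField.subset_adjoin K _ ⟨w, hw, rfl⟩)
      (IntermediateField.algebraMap_mem _ c)
  exact h he

/-- A translation maps `K(w : w ≠ v)[v]` to itself and preserves degrees in `v`. -/
theorem exists_evalVar_lift {τ : RatFun K m ≃ₐ[K] RatFun K m} (hτ : τ ∈ translations K m) :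
    ∃ τ' : Polynomial (fieldOmit K m v) →+* Polynomial (fieldOmit K m v),
      (∀ p, evalVar v (τ' p) = τ (evalVar v p)) ∧ ∀ p, (τ' p).degree = p.degree := by
  let τE : fieldOmit K m v →+* fieldOmit K m v :=
    ((τ : RatFun K m →+* RatFun K m).comp
      (algebraMap (fieldOmit K m v) (RatFun K m))).codRestrict (fieldOmit K m v)
        (fun e => apply_mem_fieldOmit v hτ e.2)
  obtain ⟨c, hc⟩ := hτ v
  let c' : fieldOmit K m v := algebraMap K _ c
  refine ⟨(Polynomial.compRingHom (Polynomial.X + Polynomial.C c')).comp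
    (Polynomial.mapRingHom τE), fun p => ?_, fun p => ?_⟩
  · refine DFunLike.congr_fun (f := (evalVar v).comp
      ((Polynomial.compRingHom (Polynomial.X + Polynomial.C c')).comp (Polynomial.mapRingHom τE)))
      (g := (τ : RatFun K m →+* RatFun K m).comp (evalVar v)) ?_ p
    refine Polynomial.ringHom_ext (fun e => ?_) ?_
    · simp only [RingHom.comp_apply, Polynomial.coe_mapRingHom, Polynomial.map_C,
        Polynomial.coe_compRingHom_apply, Polynomial.C_comp, evalVar_C]
      rfl
    · simp only [RingHom.comp_apply, Polynomial.coe_mapRingHom, Polynomial.map_X,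
        Polynomial.coe_compRingHom_apply, Polynomial.X_comp, map_add, evalVar_C, evalVar_X]
      exact hc.symm
  · change (Polynomial.taylor c' (p.map τE)).degree = p.degree
    rw [Polynomial.degree_taylor, Polynomial.degree_map]

end TranslateOne

/-! ### Splitting off the part of a rational function with prescribed denominators -/

section Parts

variable {K : Type*} [Field K] {m : ℕ} {v : Var m}

/-- The rational functions that, as functions of `v`, are proper fractions whose denominators are
products of elements of `T`. -/
def properPart (T : Set (Polynomial (fieldOmit K m v))) : AddSubgroup (RatFun K m) where
  carrier := {f | ∃ p s, s ∈ Submonoid.closure T ∧ s ≠ 0 ∧ p.degree < s.degree ∧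
    f = evalVar v p / evalVar v s}
  zero_mem' := ⟨0, 1, one_mem _, one_ne_zero, by simp, by simp⟩
  neg_mem' := by
    rintro _ ⟨p, s, hs, hs0, hd, rfl⟩
    exact ⟨-p, s, hs, hs0, by rwa [Polynomial.degree_neg], by rw [map_neg, neg_div]⟩
  add_mem' := by
    rintro _ _ ⟨p, s, hs, hs0, hd, rfl⟩ ⟨p', s', hs', hs0', hd', rfl⟩
    refine ⟨p * s' + s * p', s * s', mul_mem hs hs', mul_ne_zero hs0 hs0', ?_, ?_⟩
    · refine (Polynomial.degree_add_le _ _).trans_lt (max_lt ?_ ?_)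
      · rw [Polynomial.degree_mul, Polynomial.degree_mul]
        exact WithBot.add_lt_add_right (by rwa [Ne, Polynomial.degree_eq_bot]) hd
      · rw [Polynomial.degree_mul, Polynomial.degree_mul]
        exact WithBot.add_lt_add_left (by rwa [Ne, Polynomial.degree_eq_bot]) hd'
    · rw [map_add, map_mul, map_mul, map_mul, div_add_div]
      · exact (map_ne_zero_iff _ (evalVar_injective v)).2 hs0
      · exact (map_ne_zero_iff _ (evalVar_injective v)).2 hs0'

/-- The rational functions with a denominator, as functions of `v`, coprime to all elements
of `T`. -/
def coprimePart (T : Set (Polynomial (fieldOmit K m v))) : AddSubgroup (RatFun K m) where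
  carrier := {f | ∃ p q, q ≠ 0 ∧ (∀ b ∈ T, IsCoprime q b) ∧ f = evalVar v p / evalVar v q}
  zero_mem' := ⟨0, 1, one_ne_zero, fun _ _ => isCoprime_one_left, by simp⟩
  neg_mem' := by
    rintro _ ⟨p, q, hq, hc, rfl⟩
    exact ⟨-p, q, hq, hc, by rw [map_neg, neg_div]⟩
  add_mem' := by
    rintro _ _ ⟨p, q, hq, hc, rfl⟩ ⟨p', q', hq', hc', rfl⟩
    refine ⟨p * q' + q * p', q * q', mul_ne_zero hq hq',
      fun b hb => (hc b hb).mul_left (hc' b hb), ?_⟩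
    rw [map_add, map_mul, map_mul, map_mul, div_add_div]
    · exact (map_ne_zero_iff _ (evalVar_injective v)).2 hq
    · exact (map_ne_zero_iff _ (evalVar_injective v)).2 hq'

theorem isCoprime_of_mem_closure {T : Set (Polynomial (fieldOmit K m v))}
    {q s : Polynomial (fieldOmit K m v)} (hq : ∀ b ∈ T, IsCoprime q b)
    (hs : s ∈ Submonoid.closure T) : IsCoprime q s := by
  induction hs using Submonoid.closure_induction with
  | mem b hb => exact hq b hb
  | one => exact isCoprime_one_right
  | mul a b _ _ ha hb => exact ha.mul_right hb

theorem eq_zero_of_mem_properPart_of_mem_coprimePart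
    {T : Set (Polynomial (fieldOmit K m v))} {f : RatFun K m}
    (h₁ : f ∈ properPart T) (h₂ : f ∈ coprimePart T) : f = 0 := by
  obtain ⟨p, s, hs, hs0, hd, rfl⟩ := h₁
  obtain ⟨p', q, hq, hc, h⟩ := h₂
  have hinj := evalVar_injective (K := K) v
  rw [div_eq_div_iff ((map_ne_zero_iff _ hinj).2 hs0) ((map_ne_zero_iff _ hinj).2 hq),
    ← map_mul, ← map_mul] at h
  have h' : s ∣ p * q := ⟨p', by rw [hinj h, mul_comm]⟩
  have h'' := (isCoprime_of_mem_closure hc hs).symm.dvd_of_dvd_mul_right h'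
  rw [Polynomial.eq_zero_of_dvd_of_degree_lt h'' hd, map_zero, zero_div]

/-- Sorting the irreducible factors of `q`: those dividing some element of `T` are absorbed into a
product of elements of `T`, the others are coprime to `T`. -/
theorem exists_dvd_mul_isCoprime {T : Set (Polynomial (fieldOmit K m v))} (hT : 0 ∉ T)
    {q : Polynomial (fieldOmit K m v)} (hq : q ≠ 0) :
    ∃ s ∈ Submonoid.closure T, ∃ q', s ≠ 0 ∧ q' ≠ 0 ∧ q ∣ s * q' ∧ ∀ b ∈ T, IsCoprime q' b := by
  induction q using WfDvdMonoid.induction_on_irreducible with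
  | zero => exact absurd rfl hq
  | unit u hu =>
    exact ⟨1, one_mem _, 1, one_ne_zero, one_ne_zero, hu.dvd, fun _ _ => isCoprime_one_left⟩
  | mul a i ha hi ih =>
    obtain ⟨s, hs, q', hs0, hq0, hdvd, hc⟩ := ih ha
    by_cases h : ∀ b ∈ T, IsCoprime i b
    · refine ⟨s, hs, i * q', hs0, mul_ne_zero hi.ne_zero hq0, ?_,
        fun b hb => (h b hb).mul_left (hc b hb)⟩
      rw [mul_left_comm]
      exact mul_dvd_mul_left i hdvd
    · push Not at h
      obtain ⟨b, hb, hib⟩ := h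
      rw [hi.coprime_iff_not_dvd, not_not] at hib
      refine ⟨b * s, mul_mem (Submonoid.subset_closure hb) hs, q',
        mul_ne_zero (fun h0 => hT (h0 ▸ hb)) hs0, hq0, ?_, hc⟩
      rw [mul_assoc]
      exact mul_dvd_mul hib hdvd

/-- Every rational function is the sum of a proper fraction with denominator composed of
elements of `T` and of a fraction with denominator coprime to `T`. -/
theorem exists_properPart_add_coprimePart {T : Set (Polynomial (fieldOmit K m v))} (hT : 0 ∉ T)
    (g : RatFun K m) : ∃ α ∈ properPart T, ∃ β ∈ coprimePart T, g = α + β := by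
  obtain ⟨p, q, hq, rfl⟩ := exists_evalVar_div v g
  obtain ⟨s, hs, q', hs0, hq0, ⟨r, hr⟩, hc⟩ := exists_dvd_mul_isCoprime hT hq
  obtain ⟨a, b, hab⟩ := isCoprime_of_mem_closure hc hs
  have hinj := evalVar_injective (K := K) v
  have hs' := (map_ne_zero_iff _ hinj).2 hs0
  have hq' := (map_ne_zero_iff _ hinj).2 hq0
  have hq'' := (map_ne_zero_iff _ hinj).2 hq
  refine ⟨_, ⟨(p * r * a) % s, s, hs, hs0, EuclideanDomain.mod_lt _ hs0, rfl⟩, _,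
    ⟨(p * r * a) / s * q' + p * r * b, q', hq0, hc, rfl⟩, ?_⟩
  have h1 := congrArg (evalVar v) (EuclideanDomain.div_add_mod (p * r * a) s)
  have h2 := congrArg (evalVar v) hab
  have h3 := congrArg (evalVar v) hr
  simp only [map_add, map_mul, map_one] at h1 h2 h3 ⊢
  rw [div_add_div _ _ hs' hq', div_eq_div_iff hq'' (mul_ne_zero hs' hq')]
  linear_combination evalVar v p * h3 - evalVar v q * evalVar v q' * h1
    - evalVar v p * evalVar v q * evalVar v r * h2

end Parts

/-! ### The summable part attached to an orbit -/

section Orbit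

variable {K : Type*} [Field K] {m : ℕ} (v : Var m)

/-- The elements of the `G`-orbit of `y` that are polynomials in `v` over `K(w : w ≠ v)`. -/
def orbitLifts (n : ℕ) (y : RatFun K m) : Set (Polynomial (fieldOmit K m v)) :=
  {b | ∃ τ ∈ groupX K m n, evalVar v b = τ y}

variable {v}

theorem zero_notMem_orbitLifts {n : ℕ} {y : RatFun K m} (hy : y ≠ 0) :
    0 ∉ orbitLifts v n y := by
  rintro ⟨τ, -, h⟩
  rw [map_zero, eq_comm, EmbeddingLike.map_eq_zero_iff] at h
  exact hy h

theorem apply_mem_properPart {n : ℕ} {y : RatFun K m} {τ : RatFun K m ≃ₐ[K] RatFun K m}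
    (hτ : τ ∈ groupX K m n) {f : RatFun K m} (hf : f ∈ properPart (orbitLifts v n y)) :
    τ f ∈ properPart (orbitLifts v n y) := by
  obtain ⟨τ', h, hdeg⟩ := exists_evalVar_lift v
    (groupT_le_translations K m n (groupX_le_groupT K m n hτ))
  obtain ⟨p, s, hs, hs0, hd, rfl⟩ := hf
  refine ⟨τ' p, τ' s, ?_, ?_, ?_, ?_⟩
  · have : Submonoid.closure (orbitLifts v n y) ≤
        (Submonoid.closure (orbitLifts v n y)).comap τ' := by
      refine (Submonoid.closure_le).2 ?_
      rintro b ⟨ρ, hρ, hb⟩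
      exact Submonoid.subset_closure ⟨τ * ρ, mul_mem hτ hρ, by rw [h, hb, AlgEquiv.mul_apply]⟩
    exact this hs
  · rwa [← Polynomial.degree_ne_bot, hdeg, Polynomial.degree_ne_bot]
  · rwa [hdeg, hdeg]
  · rw [map_div₀, h, h]

theorem apply_mem_coprimePart {n : ℕ} {y : RatFun K m} {τ : RatFun K m ≃ₐ[K] RatFun K m}
    (hτ : τ ∈ groupX K m n) {f : RatFun K m} (hf : f ∈ coprimePart (orbitLifts v n y)) :
    τ f ∈ coprimePart (orbitLifts v n y) := by
  obtain ⟨τ', h, hdeg⟩ := exists_evalVar_lift v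
    (groupT_le_translations K m n (groupX_le_groupT K m n hτ))
  obtain ⟨ρ', h', -⟩ := exists_evalVar_lift v
    (groupT_le_translations K m n (groupX_le_groupT K m n (inv_mem hτ)))
  obtain ⟨p, q, hq, hc, rfl⟩ := hf
  refine ⟨τ' p, τ' q, ?_, ?_, ?_⟩
  · rwa [← Polynomial.degree_ne_bot, hdeg, Polynomial.degree_ne_bot]
  · rintro b ⟨ρ, hρ, hb⟩
    have hb' : τ' (ρ' b) = b := evalVar_injective v (by
      rw [h, h', ← AlgEquiv.mul_apply, mul_inv_cancel, AlgEquiv.one_apply])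
    rw [← hb']
    refine (hc (ρ' b) ⟨τ⁻¹ * ρ, mul_mem (inv_mem hτ) hρ, ?_⟩).map τ'
    rw [h', hb, AlgEquiv.mul_apply]
  · rw [map_div₀, h, h]

/-- The two parts attached to a `G`-orbit are stable under `G`, so a decomposition into
differences can be projected onto each of them. -/
theorem IsSummable.of_add_mem_coprimePart {n : ℕ} {y w b : RatFun K m} (hy : y ≠ 0)
    (hw : w ∈ properPart (orbitLifts v n y)) (hb : b ∈ coprimePart (orbitLifts v n y))
    (h : IsSummable n (w + b)) : IsSummable n w := by
  obtain ⟨g, hg⟩ := h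
  -- The projections of both sides differ by an element of both parts, which is zero.
  choose α hα β hβ hαβ using
    fun i => exists_properPart_add_coprimePart (zero_notMem_orbitLifts (v := v) (n := n) hy) (g i)
  refine ⟨α, ?_⟩
  have h1 : w - ∑ i : Fin m with i.val < n, delta (some i) (α i) =
      ∑ i : Fin m with i.val < n, delta (some i) (β i) - b := by
    rw [sub_eq_sub_iff_add_eq_add, hg, ← Finset.sum_add_distrib]
    refine Finset.sum_congr rfl fun i _ => ?_
    rw [hαβ i]
    simp only [delta, map_add]
    ring
  rw [← sub_eq_zero]
  refine eq_zero_of_mem_properPart_of_mem_coprimePart (T := orbitLifts v n y) ?_ ?_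
  · refine sub_mem hw (sum_mem fun i hi => sub_mem ?_ (hα i))
    exact apply_mem_properPart (shift_mem_groupX (Finset.mem_filter.1 hi).2) (hα i)
  · rw [h1]
    refine sub_mem (sum_mem fun i hi => sub_mem ?_ (hβ i)) hb
    exact apply_mem_coprimePart (shift_mem_groupX (Finset.mem_filter.1 hi).2) (hβ i)

end Orbit

/-! ### Summable functions and the action of `K(t)` and `G_t` -/

section Summable

variable {K : Type*} [Field K] {m : ℕ}

variable (K m) in
/-- The `(σ_{x_1}, …, σ_{x_n})`-summable rational functions. -/
def summables (n : ℕ) : AddSubgroup (RatFun K m) where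
  carrier := {f | IsSummable n f}
  zero_mem' := ⟨0, by simp [delta]⟩
  neg_mem' := by
    rintro _ ⟨g, rfl⟩
    refine ⟨-g, ?_⟩
    rw [← Finset.sum_neg_distrib]
    refine Finset.sum_congr rfl fun i _ => ?_
    simp only [delta, Pi.neg_apply, map_neg]
    ring
  add_mem' := by
    rintro _ _ ⟨g, rfl⟩ ⟨g', rfl⟩
    refine ⟨g + g', ?_⟩
    rw [← Finset.sum_add_distrib]
    refine Finset.sum_congr rfl fun i _ => ?_
    simp only [delta, Pi.add_apply, map_add]
    ring

theorem apply_eq_of_mem_fieldT {n : ℕ} {τ : RatFun K m ≃ₐ[K] RatFun K m} (hτ : τ ∈ groupX K m n)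
    {e : RatFun K m} (he : e ∈ fieldT K m) : τ e = e := by
  induction he using IntermediateField.adjoin_induction with
  | mem x hx =>
    obtain rfl := hx
    exact apply_var_none_of_mem_groupX hτ
  | algebraMap c => exact τ.commutes c
  | add x y _ _ hx hy => rw [map_add, hx, hy]
  | inv x _ hx => rw [map_inv₀, hx]
  | mul x y _ _ hx hy => rw [map_mul, hx, hy]

/-- Summability is preserved by `e σ` for `e ∈ K(t)` and `σ ∈ G_t`, as these commute with the
difference operators. -/
theorem IsSummable.mul_apply {n : ℕ} {f : RatFun K m} (hf : IsSummable n f) {e : RatFun K m}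
    (he : e ∈ fieldT K m) {τ : RatFun K m ≃ₐ[K] RatFun K m} (hτ : τ ∈ groupT K m n) :
    IsSummable n (e * τ f) := by
  obtain ⟨g, rfl⟩ := hf
  refine ⟨fun i => e * τ (g i), ?_⟩
  rw [map_sum, Finset.mul_sum]
  refine Finset.sum_congr rfl fun i hi => ?_
  have hi' := shift_mem_groupX (K := K) (Finset.mem_filter.1 hi).2
  have hc : shift K (some i) (τ (g i)) = τ (shift K (some i) (g i)) :=
    DFunLike.congr_fun (groupT_comm K m n (groupX_le_groupT K m n hi') hτ) (g i)
  rw [delta, delta, map_mul, apply_eq_of_mem_fieldT hi' he, hc, map_sub, mul_sub]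

theorem fieldT_le_fieldOmit {v : Var m} (hv : v ≠ none) : fieldT K m ≤ fieldOmit K m v :=
  IntermediateField.adjoin.mono K _ _ (by
    rintro _ rfl
    exact ⟨none, hv.symm, rfl⟩)

theorem HasTelescoper.of_isSummable {n : ℕ} {f : RatFun K m}
    (h : IsSummable n f) : HasTelescoper n f := by
  have hC : (SkewPolynomial.C (1 : fieldT K m) : RecOp K m) ≠ 0 := by
    rw [← SkewPolynomial.monomial_zero_left, Ne, SkewPolynomial.monomial_eq_zero_iff]
    exact one_ne_zero
  refine ⟨SkewPolynomial.C 1, hC, ?_⟩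
  rw [RecOp.apply, SkewPolynomial.sum_C_index (by simp)]
  simpa using h

end Summable

/-! ### Shifts of an irreducible polynomial -/

section IrreducibleShift

variable {K : Type*} [Field K] {m : ℕ} (v : Var m)

theorem exists_irreducible_apply {d : Poly K m} (hd : Irreducible d)
    {τ : RatFun K m ≃ₐ[K] RatFun K m} (hτ : τ ∈ translations K m) :
    ∃ q : Poly K m, Irreducible q ∧
      algebraMap (Poly K m) (RatFun K m) q = τ (algebraMap (Poly K m) (RatFun K m) d) ∧
      MvPolynomial.degreeOf v q = MvPolynomial.degreeOf v d := by
  obtain ⟨c, hc⟩ := exists_polyTranslate hτ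
  obtain ⟨τ', h, hdeg⟩ := exists_evalVar_lift v hτ
  have hq : Irreducible (polyTranslate c d) := (MulEquiv.irreducible_iff (polyTranslate c)).2 hd
  refine ⟨polyTranslate c d, hq, (hc d).symm, ?_⟩
  have h1 : liftPoly v (polyTranslate c d) = τ' (liftPoly v d) := evalVar_injective v (by
    rw [h, evalVar_liftPoly, evalVar_liftPoly, hc])
  have h2 := hdeg (liftPoly v d)
  rw [← h1, degree_liftPoly v hq.ne_zero, degree_liftPoly v hd.ne_zero] at h2
  exact_mod_cast h2

theorem pow_shift_none_mem_groupT (n k : ℕ) : shift K none ^ k ∈ groupT K m n :=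
  pow_mem (shift_none_mem_groupT K m n) k

theorem iterShiftT_ne_zero {d : Poly K m} (hd : d ≠ 0) (k : ℕ) : iterShiftT k d ≠ 0 := by
  rw [iterShiftT, Ne, EmbeddingLike.map_eq_zero_iff, FaithfulSMul.algebraMap_eq_zero_iff]
  exact hd

/-- If two translates of `d` under `G_t` are associated, then they are equal. -/
theorem apply_eq_of_associated {d : Poly K m} (hd : d ≠ 0) {σ τ : RatFun K m ≃ₐ[K] RatFun K m}
    (hσ : σ ∈ translations K m) (hτ : τ ∈ translations K m) {p q : Poly K m}
    (hp : algebraMap (Poly K m) (RatFun K m) p = σ (algebraMap (Poly K m) (RatFun K m) d))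
    (hq : algebraMap (Poly K m) (RatFun K m) q = τ (algebraMap (Poly K m) (RatFun K m) d))
    (h : Associated p q) : σ (algebraMap (Poly K m) (RatFun K m) d) =
      τ (algebraMap (Poly K m) (RatFun K m) d) := by
  obtain ⟨u, rfl⟩ := h
  obtain ⟨c, -, hc⟩ := MvPolynomial.isUnit_iff_eq_C_of_isReduced.1 u.isUnit
  obtain ⟨r, hr⟩ := exists_polyTranslate (mul_mem (inv_mem hσ) hτ)
  have h1 : (σ⁻¹ * τ) (algebraMap (Poly K m) (RatFun K m) d) =
      algebraMap (Poly K m) (RatFun K m) (MvPolynomial.C c * d) := by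
    rw [AlgEquiv.mul_apply, ← hq, map_mul, hp, hc, map_mul, map_mul, mul_comm]
    congr 1
    · rw [← MvPolynomial.algebraMap_eq, ← IsScalarTower.algebraMap_apply K (Poly K m) (RatFun K m),
        AlgEquiv.commutes]
    · exact σ.symm_apply_apply _
  rw [hr] at h1
  have hc1 := eq_one_of_polyTranslate_eq r hd (IsFractionRing.injective _ (RatFun K m) h1)
  rw [← hp, ← hq, hc, hc1, map_one, mul_one]

/-- When `G_{t,d} / G_d` has rank zero, distinct `σ_t`-shifts of `d` have coprime `G`-orbits. -/
theorem isCoprime_of_mem_orbitLifts [CharZero K] {n : ℕ} {d : Poly K m} (hd : Irreducible d)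
    (hrank : isotropyQuotientRank n (algebraMap (Poly K m) (RatFun K m) d) = 0)
    (hdeg : MvPolynomial.degreeOf v d ≠ 0) {k l : ℕ} (hkl : k ≠ l)
    {p b : Polynomial (fieldOmit K m v)} (hp : evalVar v p = iterShiftT k d)
    (hb : b ∈ orbitLifts v n (iterShiftT l d)) : IsCoprime p b := by
  obtain ⟨τ, hτ, hb⟩ := hb
  have hτ' := groupX_le_groupT K m n hτ
  have hk := pow_shift_none_mem_groupT (K := K) (m := m) n k
  have hl := mul_mem hτ' (pow_shift_none_mem_groupT (K := K) (m := m) n l)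
  obtain ⟨q, hq, hqd, hqdeg⟩ :=
    exists_irreducible_apply v hd (groupT_le_translations K m n hk)
  obtain ⟨r, hr, hrd, hrdeg⟩ :=
    exists_irreducible_apply v hd (groupT_le_translations K m n hl)
  obtain rfl : p = liftPoly v q := evalVar_injective v (by
    rw [hp, evalVar_liftPoly, hqd, iterShiftT])
  obtain rfl : b = liftPoly v r := evalVar_injective v (by
    rw [hb, evalVar_liftPoly, hrd, iterShiftT, AlgEquiv.mul_apply])
  refine isCoprime_liftPoly v hq hr (by rwa [hrdeg]) (by rwa [hqdeg]) fun hass => hkl ?_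
  have heq := apply_eq_of_associated hd.ne_zero (groupT_le_translations K m n hk)
    (groupT_le_translations K m n hl) hqd hrd hass
  have hfix := apply_var_none_of_isotropyQuotientRank_eq_zero hrank
    (mul_mem (inv_mem hk) hl) (by
      rw [AlgEquiv.mul_apply, ← heq]
      exact (shift K none ^ k).symm_apply_apply _)
  have : CharZero (RatFun K m) :=
    charZero_of_injective_algebraMap (algebraMap K (RatFun K m)).injective
  have h1 : (τ * shift K none ^ l : RatFun K m ≃ₐ[K] RatFun K m) (var K none) =
      (shift K none ^ k : RatFun K m ≃ₐ[K] RatFun K m) (var K none) :=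
    ((shift K none ^ k : RatFun K m ≃ₐ[K] RatFun K m).symm_apply_eq).1 hfix
  rw [AlgEquiv.mul_apply, pow_shift_none_apply_var, pow_shift_none_apply_var, map_add,
    map_natCast, apply_var_none_of_mem_groupX hτ, add_right_inj] at h1
  exact (Nat.cast_injective h1).symm

theorem exists_mul_pow_shift_simpleFraction (hv : v ≠ none) {e : RatFun K m} (he : e ∈ fieldT K m)
    (a : Polynomial (fieldOmit K m v)) (d : Poly K m) (i j l : ℕ) :
    ∃ p : Polynomial (fieldOmit K m v), p.degree ≤ a.degree ∧
      e * (shift K none ^ l) (simpleFraction v a d i j) =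
        evalVar v p / iterShiftT (l + i) d ^ j := by
  obtain ⟨τ', h, hdeg⟩ := exists_evalVar_lift v
    (groupT_le_translations K m 0 (pow_shift_none_mem_groupT (K := K) (m := m) 0 l))
  refine ⟨Polynomial.C ⟨e, fieldT_le_fieldOmit hv he⟩ * τ' a, ?_, ?_⟩
  · rw [← hdeg a, Polynomial.degree_mul]
    exact (add_le_add_left Polynomial.degree_C_le _).trans_eq (zero_add _)
  · rw [map_mul, evalVar_C, h, simpleFraction, map_div₀, map_pow, iterShiftT, iterShiftT, pow_add,
      AlgEquiv.mul_apply, mul_div_assoc]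
    rfl

end IrreducibleShift

/-! ### Separating the terms of a telescoper -/

section Separation

variable {K : Type*} [Field K] [CharZero K] {m : ℕ} {v : Var m}

/-- The lowest term `e_{l₀} S_t^{l₀}` of a telescoper isolates the simple fractions one after the
other: `e_{l₀} σ_t^{l₀}(a_i / σ_t^i(d)^j)` is, apart from contributions of smaller indices, the only
term with denominator in the `G`-orbit of `σ_t^{l₀+i}(d)`. -/
theorem isSummable_simpleFraction_of_isTelescoper {n : ℕ} (hv : v ≠ none) {I j : ℕ} (hj : j ≠ 0)
    {d : Poly K m} (hd : Irreducible d)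
    (hrank : isotropyQuotientRank n (algebraMap (Poly K m) (RatFun K m) d) = 0)
    {a : ℕ → Polynomial (fieldOmit K m v)}
    (ha : ∀ i ≤ I, (a i).degree < (MvPolynomial.degreeOf v d : WithBot ℕ))
    {L : RecOp K m}
    (hL : IsTelescoper n L (∑ i ∈ Finset.range (I + 1), simpleFraction v (a i) d i j))
    (i : ℕ) (hi : i ≤ I) : IsSummable n (simpleFraction v (a i) d i j) := by
  -- If `d` does not involve `v`, the degree bound forces the numerators to vanish.
  rcases eq_or_ne (MvPolynomial.degreeOf v d) 0 with h0 | hdeg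
  · have h1 := ha i hi
    rw [h0, Nat.cast_zero, ← not_le, Polynomial.zero_le_degree_iff, not_not] at h1
    rw [h1, simpleFraction, map_zero, zero_div]
    exact (summables K m n).zero_mem
  obtain ⟨hL0, hsum⟩ := hL
  have hne : L.support.Nonempty := by
    rwa [Finset.nonempty_iff_ne_empty, Ne, SkewPolynomial.support_eq_empty]
  obtain ⟨l₀, hl₀, hmin⟩ := L.support.exists_min_image id hne
  induction i using Nat.strong_induction_on with
  | _ i ih =>
  set y := iterShiftT (l₀ + i) d with hy
  have hy0 : y ≠ 0 := iterShiftT_ne_zero hd.ne_zero _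
  let term : ℕ × ℕ → RatFun K m := fun x =>
    (L.coeff x.1 : RatFun K m) * (shift K none ^ x.1) (simpleFraction v (a x.2) d x.2 j)
  set P := L.support ×ˢ Finset.range (I + 1) with hP
  have happly : L.apply (∑ i ∈ Finset.range (I + 1), simpleFraction v (a i) d i j) =
      ∑ x ∈ P, term x := by
    rw [RecOp.apply, SkewPolynomial.sum_def, hP, Finset.sum_product]
    refine Finset.sum_congr rfl fun l _ => ?_
    rw [map_sum, Finset.mul_sum]
  have hmem : (l₀, i) ∈ P := Finset.mem_product.2 ⟨hl₀, Finset.mem_range.2 (by omega)⟩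
  have hrest : ∑ x ∈ P.erase (l₀, i), term x ∈
      coprimePart (orbitLifts v n y) ⊔ summables K m n := by
    refine sum_mem fun x hx => ?_
    obtain ⟨l, i'⟩ := x
    obtain ⟨hxne, hx⟩ := Finset.mem_erase.1 hx
    obtain ⟨hl, hi'⟩ := Finset.mem_product.1 hx
    have hll : l₀ ≤ l := hmin l hl
    -- For `i' < i` the term is summable by induction. Otherwise `l + i' > l₀ + i`, as `l ≥ l₀`, so
    -- its denominator is coprime to the orbit of `y`.
    rcases lt_or_ge i' i with hlt | hge
    · exact AddSubgroup.mem_sup_right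
        ((ih i' hlt (by omega)).mul_apply (L.coeff l).2 (pow_shift_none_mem_groupT n l))
    · have hne' : l + i' ≠ l₀ + i := by
        intro h
        exact hxne (Prod.ext (by simp only; omega) (by simp only; omega))
      refine AddSubgroup.mem_sup_left ?_
      obtain ⟨p, -, hp⟩ := exists_mul_pow_shift_simpleFraction v hv (L.coeff l).2 (a i') d i' j l
      obtain ⟨q, hq, hqd, -⟩ := exists_irreducible_apply v hd
        (groupT_le_translations K m n (pow_shift_none_mem_groupT n (l + i')))
      have hev : evalVar v (liftPoly v q) = iterShiftT (l + i') d := by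
        rw [evalVar_liftPoly, hqd, iterShiftT]
      refine ⟨p, liftPoly v q ^ j, pow_ne_zero _ ?_, fun b hb => ?_, ?_⟩
      · rw [← Polynomial.degree_ne_bot, degree_liftPoly v hq.ne_zero]
        exact WithBot.coe_ne_bot
      · exact (isCoprime_of_mem_orbitLifts v hd hrank hdeg hne' hev hb).pow_left
      · rw [map_pow, hev]
        exact hp
  have hmain : term (l₀, i) ∈ properPart (orbitLifts v n y) := by
    obtain ⟨p, hpd, hp⟩ := exists_mul_pow_shift_simpleFraction v hv (L.coeff l₀).2 (a i) d i j l₀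
    obtain ⟨q, hq, hqd, hqdeg⟩ := exists_irreducible_apply v hd
      (groupT_le_translations K m n (pow_shift_none_mem_groupT n (l₀ + i)))
    have hev : evalVar v (liftPoly v q) = y := by
      rw [evalVar_liftPoly, hqd, hy, iterShiftT]
    have hq0 : liftPoly v q ≠ 0 := by
      rw [← Polynomial.degree_ne_bot, degree_liftPoly v hq.ne_zero]
      exact WithBot.coe_ne_bot
    refine ⟨p, liftPoly v q ^ j, pow_mem (Submonoid.subset_closure ?_) j,
      pow_ne_zero _ hq0, ?_, ?_⟩
    · exact ⟨1, one_mem _, by rw [hev, AlgEquiv.one_apply]⟩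
    · have h1 : p.degree < (liftPoly v q).degree := by
        rw [degree_liftPoly v hq.ne_zero, hqdeg]
        exact hpd.trans_lt (ha i hi)
      exact h1.trans_le (Polynomial.degree_le_of_dvd (dvd_pow_self _ hj) (pow_ne_zero _ hq0))
    · rw [map_pow, hev]
      exact hp
  rw [happly, ← Finset.add_sum_erase _ _ hmem] at hsum
  obtain ⟨b, hb, s, hs, hbs⟩ := AddSubgroup.mem_sup.1 hrest
  rw [← hbs, ← add_assoc] at hsum
  have hsum' : IsSummable n (term (l₀, i) + b) := by
    have h1 := (summables K m n).sub_mem hsum hs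
    rwa [add_sub_cancel_right] at h1
  have hterm := IsSummable.of_add_mem_coprimePart hy0 hmain hb hsum'
  have he0 : (L.coeff l₀ : RatFun K m) ≠ 0 := by
    simpa using SkewPolynomial.mem_support_iff.1 hl₀
  -- Undo `e_{l₀} σ_t^{l₀}`.
  have h2 := (hterm.mul_apply (inv_mem (L.coeff l₀).2) (one_mem (groupT K m n))).mul_apply
    (one_mem _) (inv_mem (pow_shift_none_mem_groupT n l₀))
  rw [AlgEquiv.one_apply, one_mul, inv_mul_cancel_left₀ he0] at h2
  rwa [← AlgEquiv.mul_apply, inv_mul_cancel, AlgEquiv.one_apply] at h2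

end Separation

end ShiftTelescoper

end

theorem mainTheorem5 {K : Type*} [Field K] [CharZero K]
    (m n : ℕ) (hn : 1 ≤ n) (hnm : n ≤ m)
    (I j : ℕ) (hj : j ≠ 0)
    (d : ShiftTelescoper.Poly K m) (hd : Irreducible d)
    (h_inequiv : ∀ i i', i ≤ I → i' ≤ I → i ≠ i' →
      ¬ ShiftTelescoper.ShiftEquivalent (ShiftTelescoper.groupX K m n)
        (ShiftTelescoper.iterShiftT i d) (ShiftTelescoper.iterShiftT i' d))
    (a : ℕ → Polynomial (ShiftTelescoper.fieldOmit K m (ShiftTelescoper.x₁ (hn.trans hnm))))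
    (ha : ∀ i ≤ I, (a i).degree <
      (MvPolynomial.degreeOf (ShiftTelescoper.x₁ (hn.trans hnm)) d : WithBot ℕ))
    (f : ShiftTelescoper.RatFun K m)
    (hf : f = ∑ i ∈ Finset.range (I + 1),
      ShiftTelescoper.simpleFraction (ShiftTelescoper.x₁ (hn.trans hnm)) (a i) d i j)
    (hrank : ShiftTelescoper.isotropyQuotientRank n
      (algebraMap (ShiftTelescoper.Poly K m) (ShiftTelescoper.RatFun K m) d) = 0) :
    ShiftTelescoper.HasTelescoper n f ↔
      ∀ i ≤ I, ShiftTelescoper.IsSummable n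
        (ShiftTelescoper.simpleFraction (ShiftTelescoper.x₁ (hn.trans hnm)) (a i) d i j) := by
  subst hf
  constructor
  · rintro ⟨L, hL⟩
    exact ShiftTelescoper.isSummable_simpleFraction_of_isTelescoper
      (by simp [ShiftTelescoper.x₁]) hj hd hrank ha hL
  · intro h
    refine ShiftTelescoper.HasTelescoper.of_isSummable ?_
    exact (ShiftTelescoper.summables K m n).sum_mem fun i hi =>
      h i (Nat.lt_succ_iff.1 (Finset.mem_range.1 hi))
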